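/- Let $N,J,K\ge 1$ be integers and $M=J+K$ (there are $N$ users and $M$ items; every user has $J$ positive and $K$ unobserved items), and let $\phi:\mathbb R\to(0,\infty)$. For a score vector $x\in\mathbb R^M$ and a set $S\subseteq\{1,\dots,M\}$ put $$p(S\mid x)=\prod_{j\in S}\frac{\phi(x_j)}{\phi(x_j)+\sum_{k\notin S}\phi(x_k)},$$ and for $X\in\mathbb R^{N\times M}$ with rows $X_i$ put $p(S_1,\dots,S_N\mid X)=\prod_{i=1}^N p(S_i\mid X_i)$. Let $\mathcal X\subseteq\mathbb R^{N\times M}$ be a feasible set and $X^*\in\mathcal X$. The data are independent random sets $P_1,\dots,P_N$, generated from $X^*$ as follows: $P_i$ has the law of the set of indices of the $J$ smallest among independent exponential variables $Y_{i1},\dots,Y_{iM}$ with rates $\phi(X^*_{i1}),\dots,\phi(X^*_{iM})$. Let $\hat X$ be a constrained maximum-likelihood estimator, i.e. almost surely $\hat X\in\mathcal X$ minimizes $-\log p(P_1,\dots,P_N\mid X)$ over $X\in\mathcal X$. The excess risk is $$D(X^*,X)=\frac1N\sum_{i=1}^N\mathbb E\,\log\frac{p(P_i\mid X^*_i)}{p(P_i\mid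 X_i)},$$ where the expectation is over a fresh draw of $P_i$ generated from $X^*$, with $X$ held fixed. Let $\mathcal Z=\{\log\phi(X): X\in\mathcal X\}$ (entrywise), suppose that $\|Z_i\|_\infty\le\alpha$ for all $Z\in\mathcal Z$ and all rows $i$, let $\|Z\|_{\infty,2}=\sqrt{\sum_{i=1}^N\|Z_i\|_\infty^2}$, let $\mathcal N(u,\mathcal Z,\|\cdot\|_{\infty,2})$ be the least number of balls of radius $u$ in this norm that cover $\mathcal Z$, and let $g(\mathcal Z)=\int_0^\infty\sqrt{\ln\mathcal N(u,\mathcal Z,\|\cdot\|_{\infty,2})}\,du$. Then $$D(X^*,\hat X)\le O_{\mathbb P}\!\left(g(\mathcal Z)\,\frac{\sqrt M}{N}\left(1+\frac JK\right)\right),$$ that is: for all $\alpha$ and $\varepsilon>0$ there is a constant $C>0$, depending only on $\alpha$ and $\varepsilon$, such that in every such setting $$\mathbb P\Big(D(X^*,\hat X)>C\,g(\mathcal Z)\,\tfrac{\sqrt M}{N}\big(1+\tfrac JK\big)\Big)\le\varepsilon .$$ For $J=1$, where $p(\cdot\mid x)$ is a probability distribution on the $J$-element sets and $D$ is a Kullback–Leibler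 divergence, one has moreover $D(X^*,X)\ge0$ for every $X$, so that the bound is then two-sided. -/

import Mathlib

open MeasureTheory ProbabilityTheory
open scoped ENNReal NNReal

noncomputable section

namespace SetRank

/-- The setwise preference probability of one user with scores `x`, positive set `S` and
unobserved set `Sᶜ`: the product over `j ∈ S` of `φ (x j) / (φ (x j) + ∑ k ∈ Sᶜ, φ (x k))`. -/
def setPref (φ : ℝ → ℝ) {M : ℕ} (x : Fin M → ℝ) (S : Finset (Fin M)) : ℝ :=
  ∏ j ∈ S, φ (x j) / (φ (x j) + ∑ k ∈ Sᶜ, φ (x k))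

/-- The setwise preference probability of all users; `S i` is the positive set of user `i`. -/
def totalPref (φ : ℝ → ℝ) {N M : ℕ} (X : Matrix (Fin N) (Fin M) ℝ)
    (S : Fin N → Finset (Fin M)) : ℝ :=
  ∏ i, setPref φ (X i) (S i)

/-- The constrained estimation problem: `X` minimizes `-log p(S | ·)` over the feasible set. -/
def IsConstrainedMLE (φ : ℝ → ℝ) {N M : ℕ} (𝓧 : Set (Matrix (Fin N) (Fin M) ℝ))
    (S : Fin N → Finset (Fin M)) (X : Matrix (Fin N) (Fin M) ℝ) : Prop :=
  X ∈ 𝓧 ∧ ∀ X' ∈ 𝓧, -Real.log (totalPref φ X S) ≤ -Real.log (totalPref φ X' S)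

/-- The probability that, for independent exponential variables `y l` with rates `φ (x l)`,
every entry with index in `S` is smaller than every entry with index outside `S`. -/
def raceProb (φ : ℝ → ℝ) {M : ℕ} (x : Fin M → ℝ) (S : Finset (Fin M)) : ℝ≥0∞ :=
  Measure.pi (fun l => expMeasure (φ (x l))) {y | ∀ j ∈ S, ∀ k ∉ S, y j < y k}

/-- The random positive sets `P · i` are generated from the score matrix `Xs`: they are
independent over the users `i`, and `P · i` is distributed as the set of the indices of the `J`
smallest among independent exponential variables with rates `φ (Xs i l)`. -/
structure IsGeneratedFrom (φ : ℝ → ℝ) {N M : ℕ} (J : ℕ) (Xs : Matrix (Fin N) (Fin M) ℝ)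
    {Ω : Type*} [MeasurableSpace Ω] (μ : Measure Ω) (P : Ω → Fin N → Finset (Fin M)) : Prop where
  measurableSet_fiber : ∀ S, MeasurableSet {ω | P ω = S}
  card_eq : ∀ ω i, (P ω i).card = J
  law : ∀ S : Fin N → Finset (Fin M), (∀ i, (S i).card = J) →
    μ {ω | P ω = S} = ∏ i, raceProb φ (Xs i) (S i)

/-- The excess risk `D(Xs, X) = (1/N) ∑ i, 𝔼 log (p(P_i | Xs_i) / p(P_i | X_i))`, where the
expectation is over a fresh draw of the positive set `P_i` (of size `J`) generated from `Xs`,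
and `X` is held fixed. -/
def excessRisk (φ : ℝ → ℝ) {N M : ℕ} (J : ℕ) (Xs X : Matrix (Fin N) (Fin M) ℝ) : ℝ :=
  (1 / (N : ℝ)) * ∑ i, ∑ S ∈ Finset.powersetCard J (Finset.univ : Finset (Fin M)),
    (raceProb φ (Xs i) S).toReal * Real.log (setPref φ (Xs i) S / setPref φ (X i) S)

/-- Real `N × M` matrices with the `∞,2` norm: the `ℓ²` norm of the sup norms of the rows. -/
abbrev InfTwo (N M : ℕ) : Type := PiLp 2 (fun _ : Fin N => Fin M → ℝ)

theorem norm_infTwo {N M : ℕ} (Z : InfTwo N M) : ‖Z‖ = Real.sqrt (∑ i, ‖Z i‖ ^ 2) :=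
  PiLp.norm_eq_of_L2 Z

/-- The matrix with entries `log (φ (X i l))`. -/
def logScore (φ : ℝ → ℝ) {N M : ℕ} (X : Matrix (Fin N) (Fin M) ℝ) : InfTwo N M :=
  WithLp.toLp 2 (fun i l => Real.log (φ (X i l)))

/-- Dudley's entropy integral `∫₀^∞ √(ln 𝓝(u, 𝓩, ‖·‖_{∞,2})) du` with values in `[0, ∞]`;
the covering number counts closed balls with arbitrary centres. -/
def entropyIntegral {N M : ℕ} (𝓩 : Set (InfTwo N M)) : ℝ≥0∞ :=
  ∫⁻ u in Set.Ioi (0 : ℝ),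
    (ENNReal.log ((Metric.externalCoveringNumber u.toNNReal 𝓩 : ℕ∞) : ℝ≥0∞)).toENNReal
      ^ (1 / 2 : ℝ)

end SetRank

end

/-! ### Sensitivity of the loss to the exchange of one positive item. -/

namespace SetRank

/-! Write `L` for the centred loss process: expected minus observed negative log-likelihood, as a
function of the log-scores. Optimality of the estimator on the observed data bounds `N * D` by the
increment of `L` from the true log-scores to the estimated ones
(`IsConstrainedMLE.mul_excessRisk_le`). It remains to bound the mean of this increment at a
data-dependent index and to apply Markov's inequality.

The increments of `L` are sub-Gaussian for the `∞,2` norm (`IsGeneratedFrom.lossProcess_mgf_le`).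
Each positive set is a function of `M` independent exponential variables, and moving one of them
exchanges at most one element of the set (`firstSet_update`). Such an exchange changes the
difference of the losses at two log-score vectors at sup distance `δ` by at most a constant times
`(1 + J / K) * δ` (`setLoss_sub_swap_le`): the exchanged items contribute `2 * δ`, and each of the
other `J - 1` positive items only `O(δ / K)`, because its denominator has at least `K` comparable
summands besides the exchanged one. McDiarmid's inequality then gives a variance proxy of order `M *
(1 + J / K) ^ 2 * δ ^ 2` per user, and independence of the users adds these up to the squared `∞,2`
distance.

Dudley's chaining (`sum_selection_le_entropyIntegral`) turns this into the entropy integral. The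
data take finitely many values, so finitely many estimates matter; the chaining runs over a finite
index set and a finite probability space, and no measurable supremum is needed.

For `J = 1` the race probability equals the setwise preference, and nonnegativity of `D` is Gibbs'
inequality. -/

theorem log_div_sub_log_div_le {a b a' b' U U' r : ℝ} (ha : 0 < a) (hb : 0 < b) (ha' : 0 < a')
    (hb' : 0 < b') (hU : 0 < U) (hU' : 0 < U') (hr : 1 ≤ r) (h1 : a ≤ r * a') (h2 : b' ≤ r * b)
    (h3 : U ≤ r * U') (h4 : U' ≤ r * U) :
    (Real.log (a + U) - Real.log (b + U)) - (Real.log (a' + U') - Real.log (b' + U')) ≤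
      (r ^ 2 - 1) * (a' / (a' + U') + b / (b + U)) := by
  have hA : 0 < a + U := by positivity
  have hB : 0 < b + U := by positivity
  have hA' : 0 < a' + U' := by positivity
  have hB' : 0 < b' + U' := by positivity
  have e : (Real.log (a + U) - Real.log (b + U)) - (Real.log (a' + U') - Real.log (b' + U')) =
      Real.log ((a + U) * (b' + U') / ((a' + U') * (b + U))) := by
    rw [Real.log_div (by positivity) (by positivity), Real.log_mul hA.ne' hB'.ne',
      Real.log_mul hA'.ne' hB.ne']
    ring
  rw [e]
  refine (Real.log_le_sub_one_of_pos (by positivity)).trans ?_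
  -- In the numerator `(a + U) * (b' + U') - (a' + U') * (b + U)` the products `U * U'` cancel. Each
  -- remaining positive product is at most `r ^ 2` times its negative counterpart, and each contains
  -- an exchanged item; this is what leaves the small factors `a' / (a' + U')` and `b / (b + U)`.
  have k1 : a * b' ≤ r * a' * (r * b) := mul_le_mul h1 h2 hb'.le (by positivity)
  have k2 : a * U' ≤ r * a' * (r * U) := mul_le_mul h1 h4 hU'.le (by positivity)
  have k3 : U * b' ≤ r * U' * (r * b) := mul_le_mul h3 h2 hb'.le (by positivity)
  have hr2 : 0 ≤ r ^ 2 - 1 := by nlinarith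
  have e2 : a' / (a' + U') + b / (b + U) =
      (a' * (b + U) + b * (a' + U')) / ((a' + U') * (b + U)) := by field_simp
  rw [e2, div_sub_one (by positivity), ← mul_div_assoc]
  gcongr
  nlinarith [mul_nonneg hr2 (mul_pos ha' hb).le]

/-- Minus the logarithm of the setwise preference probability, in terms of the log-scores. -/
noncomputable def setLoss {M : ℕ} (z : Fin M → ℝ) (S : Finset (Fin M)) : ℝ :=
  ∑ j ∈ S, (Real.log (Real.exp (z j) + ∑ k ∈ Sᶜ, Real.exp (z k)) - z j)

/-- The grouping prepares the exchange of `a` and `b`: the first logarithm is symmetric in them, and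
in the term of `l ∈ R` only the leading summand depends on which of the two is unobserved. -/
theorem setLoss_insert {M : ℕ} (z : Fin M → ℝ) {R : Finset (Fin M)} {a b : Fin M} (ha : a ∉ R)
    (hb : b ∉ R) (hab : a ≠ b) :
    setLoss z (insert a R) =
      (Real.log (Real.exp (z a) + Real.exp (z b) + ∑ k ∈ (insert a (insert b R))ᶜ, Real.exp (z k))
        - z a) +
      ∑ l ∈ R, (Real.log (Real.exp (z b) +
        (Real.exp (z l) + ∑ k ∈ (insert a (insert b R))ᶜ, Real.exp (z k))) - z l) := by
  have hc : (insert a R)ᶜ = insert b (insert a (insert b R))ᶜ := by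
    ext x
    simp only [Finset.mem_compl, Finset.mem_insert]
    grind
  have hs : ∑ k ∈ (insert a R)ᶜ, Real.exp (z k) =
      Real.exp (z b) + ∑ k ∈ (insert a (insert b R))ᶜ, Real.exp (z k) := by
    rw [hc, Finset.sum_insert (by simp)]
  rw [setLoss, Finset.sum_insert ha, hs, add_assoc]
  congr 1
  refine Finset.sum_congr rfl fun l _ => ?_
  rw [add_left_comm]

theorem exp_div_le_of_abs_le {α x U : ℝ} {K : ℕ} (hK : 0 < K) (hx : |x| ≤ α)
    (hU : K * Real.exp (-α) ≤ U) :
    Real.exp x / (Real.exp x + U) ≤ Real.exp (2 * α) / K := by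
  have hK' : (0 : ℝ) < K := by exact_mod_cast hK
  have hU0 : 0 < U := lt_of_lt_of_le (by positivity) hU
  rw [div_le_div_iff₀ (by positivity) hK']
  have h1 : Real.exp x ≤ Real.exp α := Real.exp_le_exp.2 (le_of_abs_le hx)
  calc Real.exp x * K ≤ Real.exp α * K := by gcongr
    _ = Real.exp (2 * α) * (K * Real.exp (-α)) := by
      rw [mul_left_comm, ← Real.exp_add]; ring_nf
    _ ≤ Real.exp (2 * α) * (Real.exp x + U) := by
      gcongr; linarith [Real.exp_pos x]

theorem exp_two_mul_sub_one_le {δ α : ℝ} (hδ : 0 ≤ δ) (hδα : δ ≤ 2 * α) :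
    Real.exp δ ^ 2 - 1 ≤ 2 * δ * Real.exp (4 * α) := by
  have h := Real.add_one_le_exp (-(2 * δ))
  have h2 : Real.exp δ ^ 2 = Real.exp (2 * δ) := by rw [← Real.exp_nat_mul]; norm_num
  have h3 : Real.exp (2 * δ) * Real.exp (-(2 * δ)) = 1 := by rw [← Real.exp_add]; simp
  have h4 : Real.exp (2 * δ) ≤ Real.exp (4 * α) := Real.exp_le_exp.2 (by linarith)
  rw [h2]
  nlinarith [Real.exp_pos (2 * δ), mul_le_mul_of_nonneg_left h4 (by positivity : 0 ≤ 2 * δ),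
    mul_le_mul_of_nonneg_left h (Real.exp_pos (2 * δ)).le]

/-- Exchanging one element of the positive set changes the difference of two losses by at most
a multiple of the sup distance of the log-scores. -/
theorem setLoss_sub_swap_le {M J K : ℕ} (hK : 0 < K) (hM : M = J + K) {α δ : ℝ}
    {z z' : Fin M → ℝ} (hz : ∀ l, |z l| ≤ α) (hz' : ∀ l, |z' l| ≤ α)
    (hδ : ∀ l, |z l - z' l| ≤ δ) (hδα : δ ≤ 2 * α)
    {R : Finset (Fin M)} {a b : Fin M} (ha : a ∉ R) (hb : b ∉ R) (hab : a ≠ b)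
    (hR : R.card + 1 = J) :
    (setLoss z (insert a R) - setLoss z' (insert a R)) -
      (setLoss z (insert b R) - setLoss z' (insert b R)) ≤
      4 * Real.exp (6 * α) * (1 + (J : ℝ) / K) * δ := by
  have hδ0 : 0 ≤ δ := (abs_nonneg _).trans (hδ a)
  have hα0 : 0 ≤ α := (abs_nonneg _).trans (hz a)
  have hK' : (0 : ℝ) < K := by exact_mod_cast hK
  rw [setLoss_insert z ha hb hab, setLoss_insert z' ha hb hab, setLoss_insert z hb ha hab.symm,
    setLoss_insert z' hb ha hab.symm, Finset.insert_comm b a]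
  set Q := (insert a (insert b R))ᶜ with hQ
  -- `Q` is the set of items unobserved under both sets, so it has only `K - 1` elements; in `hlow`
  -- the summand of `l` itself supplies the `K`-th.
  have hQc : Q.card + 1 = K := by
    rw [hQ, Finset.card_compl, Finset.card_insert_of_notMem (by simp [hab, ha]),
      Finset.card_insert_of_notMem hb, Fintype.card_fin]
    have : (insert a (insert b R)).card ≤ M := by
      simpa using Finset.card_le_univ (insert a (insert b R))
    rw [Finset.card_insert_of_notMem (by simp [hab, ha]), Finset.card_insert_of_notMem hb] at this
    omega
  have hexp : ∀ u v : ℝ, |u - v| ≤ δ → Real.exp u ≤ Real.exp δ * Real.exp v := by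
    intro u v h
    rw [← Real.exp_add, Real.exp_le_exp]
    linarith [le_of_abs_le h]
  have hδ' : ∀ l, |z' l - z l| ≤ δ := fun l => by rw [abs_sub_comm]; exact hδ l
  have hlow : ∀ (w : Fin M → ℝ), (∀ l, |w l| ≤ α) → ∀ l,
      K * Real.exp (-α) ≤ Real.exp (w l) + ∑ k ∈ Q, Real.exp (w k) := by
    intro w hw l
    have h1 : ∀ k, Real.exp (-α) ≤ Real.exp (w k) := fun k =>
      Real.exp_le_exp.2 (neg_le_of_abs_le (hw k))
    have h2 := Finset.card_nsmul_le_sum Q (fun k => Real.exp (w k)) _ fun k _ => h1 k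
    rw [nsmul_eq_mul] at h2
    have h3 : (K : ℝ) = Q.card + 1 := by exact_mod_cast hQc.symm
    rw [h3]
    linarith [h1 l]
  -- A crude Lipschitz bound would give `O(δ)` per item and a total of order `J * δ`; the
  -- second-difference estimate with `r = exp δ` gains the factor `1 / K`.
  have hterm : ∀ l ∈ R,
      (Real.log (Real.exp (z b) + (Real.exp (z l) + ∑ k ∈ Q, Real.exp (z k))) -
        Real.log (Real.exp (z a) + (Real.exp (z l) + ∑ k ∈ Q, Real.exp (z k)))) -
      (Real.log (Real.exp (z' b) + (Real.exp (z' l) + ∑ k ∈ Q, Real.exp (z' k))) -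
        Real.log (Real.exp (z' a) + (Real.exp (z' l) + ∑ k ∈ Q, Real.exp (z' k)))) ≤
      2 * δ * Real.exp (4 * α) * (2 * (Real.exp (2 * α) / K)) := by
    intro l _
    have hU : ∀ w w' : Fin M → ℝ, (∀ l, |w l - w' l| ≤ δ) →
        Real.exp (w l) + ∑ k ∈ Q, Real.exp (w k) ≤
          Real.exp δ * (Real.exp (w' l) + ∑ k ∈ Q, Real.exp (w' k)) := by
      intro w w' h
      rw [mul_add, Finset.mul_sum]
      exact add_le_add (hexp _ _ (h l)) (Finset.sum_le_sum fun k _ => hexp _ _ (h k))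
    refine (log_div_sub_log_div_le (Real.exp_pos _) (Real.exp_pos _) (Real.exp_pos _)
      (Real.exp_pos _) (by positivity) (by positivity) (Real.one_le_exp hδ0)
      (hexp _ _ (hδ b)) (hexp _ _ (hδ' a)) (hU _ _ hδ) (hU _ _ hδ')).trans ?_
    refine mul_le_mul (exp_two_mul_sub_one_le hδ0 hδα) ?_ (by positivity) (by positivity)
    rw [two_mul]
    exact add_le_add (exp_div_le_of_abs_le hK (hz' b) (hlow z' hz' l))
      (exp_div_le_of_abs_le hK (hz a) (hlow z hz l))
  have hsum := Finset.sum_le_card_nsmul R _ _ hterm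
  simp only [Finset.sum_sub_distrib, nsmul_eq_mul] at hsum ⊢
  have e6 : Real.exp (4 * α) * Real.exp (2 * α) = Real.exp (6 * α) := by
    rw [← Real.exp_add]; ring_nf
  have e1 : (R.card : ℝ) * (2 * δ * Real.exp (4 * α) * (2 * (Real.exp (2 * α) / K))) ≤
      4 * Real.exp (6 * α) * (J / K) * δ := by
    have : (R.card : ℝ) ≤ J := by exact_mod_cast (by omega : R.card ≤ J)
    calc _ = 4 * Real.exp (6 * α) * (R.card / K) * δ := by rw [← e6]; ring
      _ ≤ _ := by gcongr
  have e2 : 2 * δ ≤ 4 * Real.exp (6 * α) * δ := by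
    have : 1 ≤ Real.exp (6 * α) := Real.one_le_exp (by positivity)
    nlinarith
  -- The symmetric logarithms cancel, so the exchanged items contribute only `(z b - z' b) + (z' a -
  -- z a)`, at most `2 * δ`.
  have e3 := le_of_abs_le (hδ b)
  have e4 := le_of_abs_le (hδ' a)
  rw [add_comm (Real.exp (z b)) (Real.exp (z a)), add_comm (Real.exp (z' b)) (Real.exp (z' a))]
  linarith

end SetRank

/-! ### Bounded differences on product spaces. -/

/-- **McDiarmid's inequality** in moment generating function form: a function on a product space
with coordinatewise oscillations at most `c` is sub-Gaussian. -/
theorem ProbabilityTheory.mgf_pi_le_of_bounded_differences {β : Type*} [MeasurableSpace β]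
    {c : ℝ} (hc : 0 ≤ c) (t : ℝ) {n : ℕ} (ν : Fin n → Measure β) [∀ i, IsProbabilityMeasure (ν i)]
    {F : (Fin n → β) → ℝ} (hF : Measurable F) {B : ℝ} (hB : ∀ x, |F x| ≤ B)
    (hd : ∀ i x y, (∀ j, j ≠ i → x j = y j) → F x - F y ≤ c) :
    ∫ x, Real.exp (t * (F x - ∫ y, F y ∂(Measure.pi ν))) ∂(Measure.pi ν) ≤
      Real.exp (n * c ^ 2 / 4 * t ^ 2 / 2) := by
  induction n with
  | zero =>
    have h0 : ∀ x, F x = F default := fun x => congrArg F (Subsingleton.elim _ _)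
    simp_rw [h0]
    simp
  | succ n ih =>
    set ν' : Fin n → Measure β := fun j => ν (Fin.succ j)
    have hmp := measurePreserving_piFinSuccAbove ν 0
    have hmp' := hmp.symm
    set e := MeasurableEquiv.piFinSuccAbove (fun _ : Fin (n + 1) => β) 0
    have hec : ∀ (a : β) (x : Fin n → β), e.symm (a, x) = Fin.cons a x := fun a x => by
      simp [e, MeasurableEquiv.piFinSuccAbove, Fin.insertNthEquiv]
    have hem : Measurable fun p : β × (Fin n → β) => (Fin.cons p.1 p.2 : Fin (n + 1) → β) := by
      simpa only [← hec] using e.symm.measurable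
    have key : ∀ g : (Fin (n + 1) → β) → ℝ, Measurable g → (∃ B, ∀ x, |g x| ≤ B) →
        ∫ x, g x ∂(Measure.pi ν) = ∫ a, ∫ x, g (Fin.cons a x) ∂(Measure.pi ν') ∂(ν 0) := by
      rintro g hg ⟨B, hB⟩
      rw [← hmp'.integral_comp' g]
      rw [integral_prod]
      · simp_rw [hec]
        rfl
      · refine Integrable.of_bound (hg.comp e.symm.measurable).aestronglyMeasurable B ?_
        exact Filter.Eventually.of_forall fun x => hB _
    have hcons : ∀ a : β, Measurable fun x : Fin n → β => (Fin.cons a x : Fin (n + 1) → β) :=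
      fun a => hem.comp measurable_prodMk_left
    -- Induction by conditioning on the first coordinate: `G` is the conditional mean. Its
    -- fluctuation is handled by Hoeffding's lemma, and that of `F` around it by the induction
    -- hypothesis.
    set G : β → ℝ := fun a => ∫ x, F (Fin.cons a x) ∂(Measure.pi ν')
    have hGm : Measurable G := by
      have : StronglyMeasurable (Function.uncurry fun (a : β) (x : Fin n → β) =>
          F (Fin.cons a x)) := (hF.comp hem).stronglyMeasurable
      exact this.integral_prod_right.measurable
    have hint : ∀ a, Integrable (fun x => F (Fin.cons a x)) (Measure.pi ν') := fun a =>
      Integrable.of_bound (hF.comp (hcons a)).aestronglyMeasurable B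
        (Filter.Eventually.of_forall fun x => hB _)
    have hGB : ∀ a, |G a| ≤ B := by
      intro a
      have := norm_integral_le_of_norm_le_const (μ := Measure.pi ν') (f := fun x => F (Fin.cons a x))
        (C := B) (Filter.Eventually.of_forall fun x => hB _)
      simpa using this
    have hGd : ∀ a b, G a - G b ≤ c := by
      intro a b
      rw [← integral_sub (hint a) (hint b)]
      have : ∫ x, (F (Fin.cons a x) - F (Fin.cons b x)) ∂(Measure.pi ν') ≤
          ∫ _, c ∂(Measure.pi ν') := by
        refine integral_mono ((hint a).sub (hint b)) (integrable_const _) fun x => ?_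
        refine hd 0 _ _ fun j hj => ?_
        obtain ⟨k, rfl⟩ := Fin.exists_succ_eq.2 hj
        simp
      simpa using this
    have hm : ∫ y, F y ∂(Measure.pi ν) = ∫ a, G a ∂(ν 0) := key F hF ⟨B, hB⟩
    set m := ∫ y, F y ∂(Measure.pi ν)
    have hGmgf : ∫ a, Real.exp (t * (G a - m)) ∂(ν 0) ≤ Real.exp (c ^ 2 / 4 * t ^ 2 / 2) := by
      have : Nonempty β := (ν 0).nonempty_of_neZero
      have hbdd : BddBelow (Set.range G) := ⟨-B, by
        rintro _ ⟨a, rfl⟩; exact neg_le_of_abs_le (hGB a)⟩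
      -- Oscillation at most `c` places `G` in an interval of length `c`, hence the proxy `c ^ 2 /
      -- 4`.
      have hIcc : ∀ a, G a ∈ Set.Icc (⨅ b, G b) ((⨅ b, G b) + c) := fun a =>
        ⟨ciInf_le hbdd a, by
          have : G a - c ≤ ⨅ b, G b := le_ciInf fun b => by linarith [hGd a b]
          linarith⟩
      have h := (hasSubgaussianMGF_of_mem_Icc (μ := ν 0) hGm.aemeasurable
        (Filter.Eventually.of_forall hIcc)).mgf_le t
      rw [← hm, mgf] at h
      refine h.trans (le_of_eq ?_)
      have : ‖(⨅ b, G b) + c - ⨅ b, G b‖ = c := by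
        rw [add_sub_cancel_left, Real.norm_of_nonneg hc]
      push_cast
      rw [this]
      congr 1
      ring
    have hbexp : ∀ u : ℝ, |u| ≤ 2 * B → |Real.exp (t * u)| ≤ Real.exp (|t| * (2 * B)) := by
      intro u hu
      rw [abs_of_pos (Real.exp_pos _), Real.exp_le_exp]
      calc t * u ≤ |t * u| := le_abs_self _
        _ = |t| * |u| := abs_mul _ _
        _ ≤ _ := by gcongr
    have hmB : |m| ≤ B := by
      have := norm_integral_le_of_norm_le_const (μ := Measure.pi ν) (f := F)
        (C := B) (Filter.Eventually.of_forall fun x => hB _)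
      simpa using this
    have h2B : ∀ u v : ℝ, |u| ≤ B → |v| ≤ B → |u - v| ≤ 2 * B := fun u v hu hv =>
      (abs_sub u v).trans (by linarith)
    rw [key (fun x => Real.exp (t * (F x - m))) (by fun_prop)
      ⟨_, fun x => hbexp _ (h2B _ _ (hB x) hmB)⟩]
    have hinner : ∀ a, ∫ x, Real.exp (t * (F (Fin.cons a x) - m)) ∂(Measure.pi ν') ≤
        Real.exp (n * c ^ 2 / 4 * t ^ 2 / 2) * Real.exp (t * (G a - m)) := by
      intro a
      have h1 := ih ν' (F := fun x => F (Fin.cons a x)) (hF.comp (hcons a)) (fun x => hB _)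
        (fun i x y h => hd (Fin.succ i) _ _ fun j hj => by
          refine Fin.cases ?_ (fun k hk => ?_) j hj
          · intro _; simp
          · simpa using h k fun h' => hk (by rw [h']))
      have h2 : ∀ x : Fin n → β, Real.exp (t * (F (Fin.cons a x) - m)) =
          Real.exp (t * (F (Fin.cons a x) - G a)) * Real.exp (t * (G a - m)) := by
        intro x
        rw [← Real.exp_add]
        ring_nf
      simp_rw [h2]
      rw [integral_mul_const]
      gcongr
    calc _ ≤ ∫ a, Real.exp (n * c ^ 2 / 4 * t ^ 2 / 2) * Real.exp (t * (G a - m)) ∂(ν 0) := by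
          refine integral_mono_of_nonneg (Filter.Eventually.of_forall fun a =>
            integral_nonneg fun x => (Real.exp_pos _).le) ?_
            (Filter.Eventually.of_forall hinner)
          refine Integrable.const_mul ?_ _
          refine Integrable.of_bound (C := Real.exp (|t| * (2 * B))) (by fun_prop) ?_
          exact Filter.Eventually.of_forall fun a => hbexp _ (h2B _ _ (hGB a) hmB)
      _ ≤ Real.exp (n * c ^ 2 / 4 * t ^ 2 / 2) * Real.exp (c ^ 2 / 4 * t ^ 2 / 2) := by
          rw [integral_const_mul]
          gcongr
      _ = _ := by
          rw [← Real.exp_add]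
          push_cast
          ring_nf

/-! ### The positive set as a function of independent exponential variables. -/

namespace SetRank

/-- `S` consists of the indices of the `J` smallest entries of `y`, ties being broken by the
index. -/
def IsFirstSet {M : ℕ} (J : ℕ) (y : Fin M → ℝ) (S : Finset (Fin M)) : Prop :=
  S.card = J ∧ ∀ j ∈ S, ∀ k ∉ S, y j < y k ∨ (y j = y k ∧ j < k)

theorem exists_isFirstSet {M : ℕ} (y : Fin M → ℝ) {J : ℕ} (hJ : J ≤ M) :
    ∃ S, IsFirstSet J y S := by
  induction J with
  | zero => exact ⟨∅, by simp [IsFirstSet]⟩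
  | succ J ih =>
    obtain ⟨S, hS, h⟩ := ih (by omega)
    have hne : Sᶜ.Nonempty := by
      rw [← Finset.card_pos, Finset.card_compl, hS, Fintype.card_fin]
      omega
    obtain ⟨m, hm, hmin⟩ := Finset.exists_min_image Sᶜ (fun k => toLex (y k, k)) hne
    rw [Finset.mem_compl] at hm
    refine ⟨insert m S, by rw [Finset.card_insert_of_notMem hm, hS], fun j hj k hk => ?_⟩
    rw [Finset.mem_insert, not_or] at hk
    rcases Finset.mem_insert.1 hj with rfl | hj
    · have h1 := hmin k (by simpa using hk.2)
      rw [Prod.Lex.toLex_le_toLex] at h1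
      rcases h1 with h1 | ⟨h1, h2⟩
      · exact Or.inl h1
      · exact Or.inr ⟨h1, lt_of_le_of_ne h2 (Ne.symm hk.1)⟩
    · exact h j hj k hk.2

theorem IsFirstSet.unique {M J : ℕ} {y : Fin M → ℝ} {S T : Finset (Fin M)}
    (hS : IsFirstSet J y S) (hT : IsFirstSet J y T) : S = T := by
  by_contra hne
  have h1 : ¬ S ⊆ T := fun h => hne (Finset.eq_of_subset_of_card_le h (by rw [hS.1, hT.1]))
  have h2 : ¬ T ⊆ S := fun h => hne (Finset.eq_of_subset_of_card_le h (by rw [hS.1, hT.1])).symm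
  obtain ⟨p, hp, hp'⟩ := Finset.not_subset.1 h1
  obtain ⟨q, hq, hq'⟩ := Finset.not_subset.1 h2
  have h3 := hS.2 p hp q hq'
  have h4 := hT.2 q hq p hp'
  grind

/-- The set of the indices of the `J` smallest entries of `y`. -/
noncomputable def firstSet {M J : ℕ} (hJ : J ≤ M) (y : Fin M → ℝ) : Finset (Fin M) :=
  (exists_isFirstSet y hJ).choose

theorem isFirstSet_firstSet {M J : ℕ} (hJ : J ≤ M) (y : Fin M → ℝ) :
    IsFirstSet J y (firstSet hJ y) :=
  (exists_isFirstSet y hJ).choose_spec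

theorem firstSet_eq_iff {M J : ℕ} (hJ : J ≤ M) (y : Fin M → ℝ) (S : Finset (Fin M)) :
    firstSet hJ y = S ↔ IsFirstSet J y S :=
  ⟨fun h => h ▸ isFirstSet_firstSet hJ y, fun h => (isFirstSet_firstSet hJ y).unique h⟩

theorem measurableSet_firstSet_eq {M J : ℕ} (hJ : J ≤ M) (S : Finset (Fin M)) :
    MeasurableSet {y : Fin M → ℝ | firstSet hJ y = S} := by
  simp only [firstSet_eq_iff, IsFirstSet]
  measurability

/-- If `p` is lost and `q` gained and neither is the moved coordinate, then `p` and `q` keep their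
relative order, which contradicts one of the two selections. So `i` lies in every such pair; being
on one side only, it makes that side a singleton, and the equal cardinalities do the same for the
other side. -/
theorem firstSet_update {M J : ℕ} (hJ : J ≤ M) {i : Fin M} {y y' : Fin M → ℝ}
    (h : ∀ j, j ≠ i → y j = y' j) :
    firstSet hJ y = firstSet hJ y' ∨ ∃ R a b, a ∉ R ∧ b ∉ R ∧ a ≠ b ∧
      firstSet hJ y = insert a R ∧ firstSet hJ y' = insert b R ∧ R.card + 1 = J := by
  obtain ⟨hS, hS'⟩ := isFirstSet_firstSet hJ y
  obtain ⟨hT, hT'⟩ := isFirstSet_firstSet hJ y'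
  set S := firstSet hJ y
  set T := firstSet hJ y'
  by_cases hne : S = T
  · exact Or.inl hne
  right
  have hcard : (S \ T).card = (T \ S).card := Finset.card_sdiff_comm (by rw [hS, hT])
  have hno : ∀ p ∈ S \ T, ∀ q ∈ T \ S, p = i ∨ q = i := by
    intro p hp q hq
    rw [Finset.mem_sdiff] at hp hq
    by_contra! hpq
    have h3 := hS' p hp.1 q hq.2
    have h4 := hT' q hq.1 p hp.2
    rw [h p hpq.1, h q hpq.2] at h3
    grind
  have hne1 : (S \ T).Nonempty := by
    rw [Finset.sdiff_nonempty]
    exact fun h => hne (Finset.eq_of_subset_of_card_le h (by rw [hS, hT]))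
  have hne2 : (T \ S).Nonempty := by
    rw [← Finset.card_pos, ← hcard, Finset.card_pos]; exact hne1
  have h1 : (S \ T).card = 1 := by
    by_cases hi : ∀ p ∈ S \ T, p = i
    · exact le_antisymm (Finset.card_le_one.2 fun p hp q hq => (hi p hp).trans (hi q hq).symm)
        hne1.card_pos
    · push Not at hi
      obtain ⟨p, hp, hpi⟩ := hi
      rw [hcard]
      have hq : ∀ q ∈ T \ S, q = i := fun q hq => (hno p hp q hq).resolve_left hpi
      exact le_antisymm (Finset.card_le_one.2 fun p hp q hq' => (hq p hp).trans (hq q hq').symm)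
        hne2.card_pos
  obtain ⟨a, ha⟩ := Finset.card_eq_one.1 h1
  obtain ⟨b, hb⟩ := Finset.card_eq_one.1 (hcard ▸ h1)
  have ha' := Finset.mem_sdiff.1 (ha ▸ Finset.mem_singleton_self a : a ∈ S \ T)
  have hb' := Finset.mem_sdiff.1 (hb ▸ Finset.mem_singleton_self b : b ∈ T \ S)
  have haR : a ∉ S ∩ T := fun h => ha'.2 (Finset.mem_inter.1 h).2
  have hbR : b ∉ S ∩ T := fun h => hb'.2 (Finset.mem_inter.1 h).1
  have hSi : S = insert a (S ∩ T) := by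
    rw [Finset.insert_eq, ← ha, Finset.sdiff_union_inter]
  have hTi : T = insert b (S ∩ T) := by
    rw [Finset.insert_eq, ← hb, Finset.inter_comm, Finset.sdiff_union_inter]
  refine ⟨S ∩ T, a, b, haR, hbR, fun h => hb'.2 (h ▸ ha'.1), hSi, hTi, ?_⟩
  rw [← Finset.card_insert_of_notMem haR, ← hSi, hS]

theorem integral_comp_firstSet {M J : ℕ} (hJ : J ≤ M) (ν : Measure (Fin M → ℝ))
    [IsProbabilityMeasure ν] (g : Finset (Fin M) → ℝ) :
    ∫ y, g (firstSet hJ y) ∂ν =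
      ∑ S ∈ Finset.powersetCard J Finset.univ, (ν {y | firstSet hJ y = S}).toReal * g S := by
  have h : ∀ y, g (firstSet hJ y) = ∑ S ∈ Finset.powersetCard J Finset.univ,
      Set.indicator {y | firstSet hJ y = S} (fun _ => g S) y := by
    intro y
    simp only [Set.indicator_apply, Set.mem_ofPred_eq]
    rw [Finset.sum_ite_eq, if_pos]
    simpa [Finset.mem_powersetCard] using (isFirstSet_firstSet hJ y).1
  simp_rw [h]
  rw [integral_finsetSum]
  · refine Finset.sum_congr rfl fun S _ => ?_
    rw [integral_indicator_const _ (measurableSet_firstSet_eq hJ S)]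
    rfl
  · exact fun S _ => (integrable_const _).indicator (measurableSet_firstSet_eq hJ S)

/-- The race event excludes ties, which the first set resolves by index. The inequality suffices:
once the race probabilities have total mass one, it must be an equality for every `S`. -/
theorem raceProb_le_firstSet (φ : ℝ → ℝ) {M J : ℕ} (hJ : J ≤ M) (x : Fin M → ℝ)
    {S : Finset (Fin M)} (hS : S.card = J) :
    raceProb φ x S ≤ Measure.pi (fun l => expMeasure (φ (x l))) {y | firstSet hJ y = S} := by
  refine measure_mono fun y hy => ?_
  exact (firstSet_eq_iff hJ y S).2 ⟨hS, fun j hj k hk => Or.inl (hy j hj k hk)⟩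

theorem sum_measure_firstSet {M J : ℕ} (hJ : J ≤ M) (ν : Measure (Fin M → ℝ))
    [IsProbabilityMeasure ν] :
    ∑ S ∈ Finset.powersetCard J Finset.univ, (ν {y | firstSet hJ y = S}).toReal = 1 := by
  simpa using (integral_comp_firstSet hJ ν fun _ => 1).symm

theorem sum_raceProb_le_one {φ : ℝ → ℝ} (hφ : ∀ x, 0 < φ x) {M J : ℕ} (hJ : J ≤ M)
    (x : Fin M → ℝ) :
    ∑ S ∈ Finset.powersetCard J Finset.univ, (raceProb φ x S).toReal ≤ 1 := by
  have : ∀ l, IsProbabilityMeasure (expMeasure (φ (x l))) := fun l =>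
    isProbabilityMeasure_expMeasure (hφ _)
  rw [← sum_measure_firstSet hJ (Measure.pi fun l => expMeasure (φ (x l)))]
  refine Finset.sum_le_sum fun S hS => ENNReal.toReal_mono (measure_ne_top _ _) ?_
  exact raceProb_le_firstSet φ hJ x (Finset.mem_powersetCard.1 hS).2

/-- A function of the random positive set which changes by at most `c` when one element is
exchanged is sub-Gaussian. -/
theorem raceProb_mgf_le {φ : ℝ → ℝ} (hφ : ∀ x, 0 < φ x) {M J : ℕ} (hJ : J ≤ M)
    (x : Fin M → ℝ)
    (hx : ∑ S ∈ Finset.powersetCard J Finset.univ, (raceProb φ x S).toReal = 1)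
    {c : ℝ} (hc : 0 ≤ c) {f : Finset (Fin M) → ℝ}
    (hf : ∀ R a b, a ∉ R → b ∉ R → a ≠ b → R.card + 1 = J →
      f (insert a R) - f (insert b R) ≤ c) (t : ℝ) :
    ∑ S ∈ Finset.powersetCard J Finset.univ, (raceProb φ x S).toReal *
      Real.exp (t * (f S - ∑ T ∈ Finset.powersetCard J Finset.univ,
        (raceProb φ x T).toReal * f T)) ≤ Real.exp (M * c ^ 2 / 4 * t ^ 2 / 2) := by
  have : ∀ l, IsProbabilityMeasure (expMeasure (φ (x l))) := fun l =>
    isProbabilityMeasure_expMeasure (hφ _)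
  set ν := Measure.pi fun l => expMeasure (φ (x l)) with hν
  -- Termwise inequality and equal sums force termwise equality, so ties need not be shown to be
  -- null.
  have heq : ∀ S ∈ Finset.powersetCard J Finset.univ,
      (raceProb φ x S).toReal = (ν {y | firstSet hJ y = S}).toReal := by
    refine (Finset.sum_eq_sum_iff_of_le fun S hS => ?_).1 (by rw [hx, sum_measure_firstSet])
    exact ENNReal.toReal_mono (measure_ne_top _ _)
      (raceProb_le_firstSet φ hJ x (Finset.mem_powersetCard.1 hS).2)
  have hsum : ∀ g : Finset (Fin M) → ℝ, ∑ S ∈ Finset.powersetCard J Finset.univ,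
      (raceProb φ x S).toReal * g S = ∫ y, g (firstSet hJ y) ∂ν := by
    intro g
    rw [integral_comp_firstSet]
    exact Finset.sum_congr rfl fun S hS => by rw [heq S hS]
  have hmeas : Measurable fun y => f (firstSet hJ y) := by
    have h : ∀ y, f (firstSet hJ y) = ∑ S, Set.indicator {y | firstSet hJ y = S}
        (fun _ => f S) y := by
      intro y
      simp [Set.indicator_apply]
    simp_rw [h]
    exact Finset.measurable_sum _ fun S _ =>
      measurable_const.indicator (measurableSet_firstSet_eq hJ S)
  rw [hsum f, hsum fun S => Real.exp (t * (f S - _))]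
  refine mgf_pi_le_of_bounded_differences hc t _ hmeas (B := ∑ S, |f S|) (fun y => ?_) ?_
  · exact Finset.single_le_sum (f := fun S => |f S|) (fun S _ => abs_nonneg _) (Finset.mem_univ _)
  · intro i y y' h
    rcases firstSet_update hJ h with h | ⟨R, a, b, ha, hb, hab, h1, h2, h3⟩
    · rw [h, sub_self]; exact hc
    · rw [h1, h2]; exact hf R a b ha hb hab h3

end SetRank

/-! ### Maximal inequality and Dudley's bound on a finite probability space. -/

section Chaining

variable {S : Type*} [Fintype S] {q : S → ℝ}

/-- The maximal inequality for finitely many sub-Gaussian variables, on a finite probability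
space and for an arbitrary selection. -/
theorem sum_selection_le_of_subgaussian (hq : ∀ s, 0 ≤ q s) (hq1 : ∑ s, q s = 1) {ι : Type*}
    {I : Finset ι} {V : ι → S → ℝ} {v : ℝ} (hv : 0 ≤ v)
    (hV : ∀ i ∈ I, ∀ t : ℝ, ∑ s, q s * Real.exp (t * V i s) ≤ Real.exp (v ^ 2 * t ^ 2 / 2))
    {i : S → ι} (hi : ∀ s, i s ∈ I) :
    ∑ s, q s * V (i s) s ≤ v * Real.sqrt (2 * Real.log I.card) := by
  have hne : Nonempty S := by
    by_contra h
    rw [not_nonempty_iff] at h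
    simp at hq1
  obtain ⟨s₀⟩ := hne
  have hcard : (1 : ℝ) ≤ I.card := by
    exact_mod_cast Finset.card_pos.2 ⟨_, hi s₀⟩
  have hL : 0 ≤ Real.log I.card := Real.log_nonneg hcard
  set L := Real.log I.card
  set E := ∑ s, q s * V (i s) s
  have key : ∀ t : ℝ, t * E ≤ L + v ^ 2 * t ^ 2 / 2 := by
    intro t
    rw [← Real.exp_le_exp, Real.exp_add, Real.exp_log (by linarith)]
    -- Jensen's inequality; afterwards the selected exponential is bounded by the sum over all of
    -- `I`.
    have h1 : Real.exp (t * E) ≤ ∑ s, q s * Real.exp (t * V (i s) s) := by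
      have := convexOn_exp.map_sum_le (t := Finset.univ) (w := q) (p := fun s => t * V (i s) s)
        (fun s _ => hq s) hq1 (fun s _ => Set.mem_univ _)
      simp only [smul_eq_mul] at this
      convert! this using 2
      rw [Finset.mul_sum]
      exact Finset.sum_congr rfl fun s _ => by ring
    calc Real.exp (t * E) ≤ ∑ s, q s * Real.exp (t * V (i s) s) := h1
      _ ≤ ∑ s, q s * ∑ j ∈ I, Real.exp (t * V j s) := by
        refine Finset.sum_le_sum fun s _ => mul_le_mul_of_nonneg_left ?_ (hq s)
        exact Finset.single_le_sum (f := fun j => Real.exp (t * V j s))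
          (fun j _ => (Real.exp_pos _).le) (hi s)
      _ = ∑ j ∈ I, ∑ s, q s * Real.exp (t * V j s) := by
        simp_rw [Finset.mul_sum]
        exact Finset.sum_comm
      _ ≤ ∑ j ∈ I, Real.exp (v ^ 2 * t ^ 2 / 2) := Finset.sum_le_sum fun j hj => hV j hj t
      _ = _ := by simp
  rcases le_or_gt E 0 with hE | hE
  · exact hE.trans (by positivity)
  rcases hv.eq_or_lt with rfl | hv
  -- With `v = 0` the bound is linear in `t`, and this `t` yields `L + 1 ≤ L`.
  · have h := key ((L + 1) / E)
    rw [div_mul_cancel₀ _ hE.ne'] at h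
    simp at h
    linarith
  -- The value of `t` that maximizes `t * E - v ^ 2 * t ^ 2 / 2`.
  · have h := key (E / v ^ 2)
    have h2 : E ^ 2 ≤ v ^ 2 * (2 * L) := by
      have e1 : E / v ^ 2 * E = E ^ 2 / v ^ 2 := by ring
      have e2 : v ^ 2 * (E / v ^ 2) ^ 2 / 2 = E ^ 2 / v ^ 2 / 2 := by field_simp
      rw [e1, e2] at h
      have h3 : E ^ 2 / v ^ 2 ≤ 2 * L := by linarith
      rwa [div_le_iff₀ (by positivity), mul_comm] at h3
    have h3 := Real.sqrt_le_sqrt h2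
    rwa [Real.sqrt_sq hE.le, Real.sqrt_mul (by positivity), Real.sqrt_sq hv.le] at h3

/-- On the dyadic interval from `D / 2 ^ (k + 2)` to `D / 2 ^ (k + 1)` the integrand is at least its
value for `e (k + 1)`. The interval has half the length of the weight `D / 2 ^ (k + 1)`, hence the
factor `2`. -/
theorem sum_mul_sqrt_log_le_lintegral {N : ℝ → ℕ∞} {e : ℕ → ℕ} {D : ℝ} (hD : 0 < D)
    (he : ∀ k, 0 < e k)
    (hN : ∀ k u, u ≤ D / 2 ^ k → (e k : ℕ∞) ≤ N u) (n : ℕ) :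
    ENNReal.ofReal (∑ k ∈ Finset.range n,
      D / 2 ^ (k + 1) * Real.sqrt (Real.log (e (k + 1)))) ≤
    2 * ∫⁻ u in Set.Ioi (0 : ℝ), (ENNReal.log ((N u : ℕ∞) : ℝ≥0∞)).toENNReal ^ (1 / 2 : ℝ) := by
  set G : ℝ → ℝ≥0∞ := fun u => (ENNReal.log ((N u : ℕ∞) : ℝ≥0∞)).toENNReal ^ (1 / 2 : ℝ)
  have hlow : ∀ k u, u ≤ D / 2 ^ k → ENNReal.ofReal (Real.sqrt (Real.log (e k))) ≤ G u := by
    intro k u hu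
    have h1 : (1 : ℝ) ≤ e k := by exact_mod_cast he k
    have h2 : ENNReal.ofReal (e k : ℝ) ≤ ((N u : ℕ∞) : ℝ≥0∞) := by
      rw [ENNReal.ofReal_natCast]
      exact_mod_cast ENat.toENNReal_mono (hN k u hu)
    have h3 := EReal.toENNReal_le_toENNReal (ENNReal.log_monotone h2)
    rw [ENNReal.log_ofReal_of_pos (by linarith), EReal.real_coe_toENNReal] at h3
    rw [Real.sqrt_eq_rpow, ← ENNReal.ofReal_rpow_of_nonneg (Real.log_nonneg h1) (by norm_num)]
    exact ENNReal.rpow_le_rpow h3 (by norm_num)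
  have hpos : ∀ k, 0 < D / 2 ^ k := fun k => by positivity
  have hind : ENNReal.ofReal (∑ k ∈ Finset.range n,
      D / 2 ^ (k + 1) * Real.sqrt (Real.log (e (k + 1)))) ≤
      2 * ∫⁻ u in Set.Ioi (D / 2 ^ (n + 1)), G u := by
    induction n with
    | zero => simp
    | succ n ih =>
      have hle : D / 2 ^ (n + 1 + 1) ≤ D / 2 ^ (n + 1) := by
        gcongr <;> norm_num
      rw [Finset.sum_range_succ, ENNReal.ofReal_add (Finset.sum_nonneg fun k _ => by positivity)
        (by positivity), ← Set.Ioc_union_Ioi_eq_Ioi hle,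
        lintegral_union measurableSet_Ioi (Set.Ioc_disjoint_Ioi le_rfl), mul_add, add_comm]
      refine add_le_add ?_ ih
      have h : ∫⁻ _ in Set.Ioc (D / 2 ^ (n + 1 + 1)) (D / 2 ^ (n + 1)),
          ENNReal.ofReal (Real.sqrt (Real.log (e (n + 1)))) ≤
          ∫⁻ u in Set.Ioc (D / 2 ^ (n + 1 + 1)) (D / 2 ^ (n + 1)), G u :=
        setLIntegral_mono' measurableSet_Ioc fun u hu => hlow _ _ hu.2
      refine le_trans (le_of_eq ?_) (mul_le_mul_right h 2)
      rw [setLIntegral_const, Real.volume_Ioc,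
        ← ENNReal.ofReal_mul (Real.sqrt_nonneg _), ← ENNReal.ofReal_ofNat,
        ← ENNReal.ofReal_mul (by norm_num)]
      congr 1
      rw [pow_succ (2 : ℝ) (n + 1)]
      field_simp
      ring
  refine hind.trans (mul_le_mul_right ?_ 2)
  exact lintegral_mono_set (Set.Ioi_subset_Ioi (hpos _).le)

/-- **Dudley's entropy bound** for a process with sub-Gaussian increments on a finite index set,
over a finite probability space and evaluated at an arbitrary random index. -/
theorem sum_selection_le_entropyIntegral (hq : ∀ s, 0 ≤ q s) (hq1 : ∑ s, q s = 1)
    {E : Type*} [MetricSpace E] {A : Set E} (hA : A.Finite) {σ : ℝ} (hσ : 0 ≤ σ)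
    {U : E → S → ℝ}
    (hU : ∀ x ∈ A, ∀ y ∈ A, ∀ t : ℝ, ∑ s, q s * Real.exp (t * (U x s - U y s)) ≤
      Real.exp ((σ * dist x y) ^ 2 * t ^ 2 / 2))
    {z : E} (hz : z ∈ A) {ζ : S → E} (hζ : ∀ s, ζ s ∈ A) :
    ENNReal.ofReal (∑ s, q s * (U (ζ s) s - U z s)) ≤ ENNReal.ofReal (24 * σ) *
      ∫⁻ u in Set.Ioi (0 : ℝ),
        (ENNReal.log ((Metric.externalCoveringNumber u.toNNReal A : ℕ∞) : ℝ≥0∞)).toENNReal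
          ^ (1 / 2 : ℝ) := by
  classical
  obtain ⟨D, hD, hDA⟩ : ∃ D : ℝ, 0 < D ∧ ∀ x ∈ A, dist x z ≤ D := by
    obtain ⟨D, hD⟩ := (hA.image fun x => dist x z).bddAbove
    exact ⟨max D 1, by positivity, fun x hx => le_max_of_le_left (hD ⟨x, hx, rfl⟩)⟩
  have hr : ∀ k : ℕ, 0 < D / 2 ^ k := fun k => by positivity
  have hfin : ∀ k : ℕ, Metric.externalCoveringNumber (D / 2 ^ k).toNNReal A ≠ ⊤ := fun k =>
    ne_top_of_le_ne_top (Set.encard_ne_top_iff.2 hA)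
      (Metric.externalCoveringNumber_le_encard_self A)
  choose e he using fun k => ENat.ne_top_iff_exists.1 (hfin k)
  have he0 : ∀ k, 0 < e k := by
    intro k
    have : 0 < Metric.externalCoveringNumber (D / 2 ^ k).toNNReal A :=
      Metric.externalCoveringNumber_pos_iff.2 ⟨z, hz⟩
    rw [← he k] at this
    exact_mod_cast this
  have hemono : ∀ k, e k ≤ e (k + 1) := by
    intro k
    have : Metric.externalCoveringNumber (D / 2 ^ k).toNNReal A ≤
        Metric.externalCoveringNumber (D / 2 ^ (k + 1)).toNNReal A := by
      refine Metric.externalCoveringNumber_anti (Real.toNNReal_le_toNNReal ?_)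
      gcongr <;> norm_num
    rw [← he k, ← he (k + 1)] at this
    exact_mod_cast this
  -- The increment hypothesis concerns points of `A` only, so external centres are replaced by
  -- centres in `A` at the price of doubling the radius. Level `0` is the single point `z`, where
  -- the chain starts.
  have hcov : ∀ k : ℕ, ∃ C : Finset E, (k = 0 → C = {z}) ∧ (∀ c ∈ C, c ∈ A) ∧ C.card ≤ e k ∧
      ∀ x ∈ A, ∃ c ∈ C, dist x c ≤ 2 * (D / 2 ^ k) := by
    intro k
    rcases k.eq_zero_or_pos with rfl | hk
    · refine ⟨{z}, fun _ => rfl, by simpa using hz, by rw [Finset.card_singleton]; exact he0 0, fun x hx => ?_⟩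
      refine ⟨z, by simp, ?_⟩
      have := hDA x hx
      simp
      linarith
    · have h1 := Metric.coveringNumber_two_mul_le_externalCoveringNumber
        (D / 2 ^ k).toNNReal A
      obtain ⟨C, hCA, hCf, hC, hCc⟩ := Metric.exists_set_encard_eq_coveringNumber
        (ne_top_of_le_ne_top (hfin k) h1)
      refine ⟨hCf.toFinset, fun h => absurd h hk.ne', fun c hc => hCA (by simpa using hc), ?_, ?_⟩
      · rw [← hCc, ← he k, hCf.encard_eq_coe_toFinset_card] at h1
        exact_mod_cast h1
      · intro x hx
        obtain ⟨c, hc, hxc⟩ := hC hx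
        refine ⟨c, by simpa using hc, ?_⟩
        have hxc' : edist x c ≤ ((2 * (D / 2 ^ k).toNNReal : ℝ≥0) : ℝ≥0∞) := hxc
        rw [edist_nndist, ENNReal.coe_le_coe, ← NNReal.coe_le_coe] at hxc'
        simpa [Real.coe_toNNReal _ (hr k).le] using hxc'
  choose C hC0 hCA hCc hCd using hcov
  choose! π hπC hπd using hCd
  have hstep : ∀ k, ∑ s, q s * (U (π (k + 1) (ζ s)) s - U (π k (ζ s)) s) ≤
      12 * σ * (D / 2 ^ (k + 1) * Real.sqrt (Real.log (e (k + 1)))) := by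
    intro k
    -- The possible links of the chain: their length is at most `2 * (D / 2 ^ k) + 2 * (D / 2 ^ (k +
    -- 1)) = 6 * (D / 2 ^ (k + 1))`, and there are at most `e (k + 1) ^ 2` of them, which costs a
    -- factor `2` after the square root. Together these give the constant `12`.
    set I : Finset (E × E) := (C (k + 1) ×ˢ C k).filter fun p => dist p.1 p.2 ≤
      6 * (D / 2 ^ (k + 1))
    have hI : ∀ s, (π (k + 1) (ζ s), π k (ζ s)) ∈ I := by
      intro s
      simp only [I, Finset.mem_filter, Finset.mem_product]
      refine ⟨⟨hπC _ _ (hζ s), hπC _ _ (hζ s)⟩, ?_⟩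
      have h1 := hπd (k + 1) _ (hζ s)
      have h2 := hπd k _ (hζ s)
      have h3 := dist_triangle_left (π (k + 1) (ζ s)) (π k (ζ s)) (ζ s)
      have h4 : D / 2 ^ k = 2 * (D / 2 ^ (k + 1)) := by rw [pow_succ]; field_simp
      rw [h4] at h2
      linarith
    have hcard : I.card ≤ e (k + 1) * e (k + 1) :=
      (Finset.card_filter_le _ _).trans ((Finset.card_product _ _).le.trans
        (Nat.mul_le_mul (hCc _) ((hCc _).trans (hemono k))))
    have hne : Nonempty S := by
      by_contra h
      rw [not_nonempty_iff] at h
      simp at hq1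
    have hcard0 : 0 < I.card := Finset.card_pos.2 ⟨_, hI hne.some⟩
    have h := sum_selection_le_of_subgaussian hq hq1 (I := I)
      (V := fun p s => U p.1 s - U p.2 s) (v := σ * (6 * (D / 2 ^ (k + 1)))) (by positivity) ?_ hI
    · refine h.trans ?_
      have h1 : Real.log I.card ≤ 2 * Real.log (e (k + 1)) := by
        have h2 : (0 : ℝ) < e (k + 1) := by exact_mod_cast he0 _
        rw [two_mul, ← Real.log_mul h2.ne' h2.ne']
        refine Real.log_le_log (by exact_mod_cast hcard0) ?_
        exact_mod_cast hcard
      have h3 : Real.sqrt (2 * Real.log I.card) ≤ 2 * Real.sqrt (Real.log (e (k + 1))) := by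
        have h4 : (2 : ℝ) * Real.log I.card ≤ 2 ^ 2 * Real.log (e (k + 1)) := by linarith
        refine (Real.sqrt_le_sqrt h4).trans ?_
        rw [Real.sqrt_mul (by positivity), Real.sqrt_sq (by norm_num)]
      calc _ ≤ σ * (6 * (D / 2 ^ (k + 1))) * (2 * Real.sqrt (Real.log (e (k + 1)))) := by gcongr
        _ = _ := by ring
    · intro p hp t
      simp only [I, Finset.mem_filter, Finset.mem_product] at hp
      refine (hU _ (hCA _ _ hp.1.1) _ (hCA _ _ hp.1.2) t).trans ?_
      rw [Real.exp_le_exp]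
      have := hp.2
      gcongr
  have htel : ∀ n, ∑ s, q s * (U (π n (ζ s)) s - U z s) ≤
      12 * σ * ∑ k ∈ Finset.range n, D / 2 ^ (k + 1) * Real.sqrt (Real.log (e (k + 1))) := by
    intro n
    induction n with
    | zero =>
      have : ∀ s, π 0 (ζ s) = z := fun s => by
        have := hπC 0 _ (hζ s)
        rwa [hC0 0 rfl, Finset.mem_singleton] at this
      simp [this]
    | succ n ih =>
      rw [Finset.sum_range_succ, mul_add]
      refine le_trans (le_of_eq ?_) (add_le_add ih (hstep n))
      rw [← Finset.sum_add_distrib]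
      exact Finset.sum_congr rfl fun s _ => by ring
  -- Since `A` is finite, a sufficiently fine net approximates each point by itself, and the
  -- telescoping sum ends exactly at `ζ s`.
  obtain ⟨n, hn⟩ : ∃ n, ∀ x ∈ A, π n x = x := by
    have hlim : Filter.Tendsto (fun n : ℕ => 2 * (D / 2 ^ n)) Filter.atTop (nhds 0) := by
      have := (tendsto_pow_atTop_nhds_zero_of_lt_one (r := (1 / 2 : ℝ)) (by norm_num)
        (by norm_num)).const_mul (2 * D)
      rw [mul_zero] at this
      refine this.congr fun n => ?_
      rw [div_pow, one_pow]
      ring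
    have hev : ∀ᶠ n : ℕ in Filter.atTop, ∀ p ∈ A ×ˢ A,
        dist p.1 p.2 ≤ 2 * (D / 2 ^ n) → p.1 = p.2 := by
      rw [Filter.eventually_all_finite (hA.prod hA)]
      intro p _
      by_cases hp : p.1 = p.2
      · exact Filter.Eventually.of_forall fun _ _ => hp
      · filter_upwards [hlim.eventually (gt_mem_nhds (dist_pos.2 hp))] with n hn h
        exact absurd h (not_le.2 hn)
    obtain ⟨n, hn⟩ := hev.exists
    exact ⟨n, fun x hx => (hn (x, π n x) ⟨hx, hCA _ _ (hπC n x hx)⟩ (hπd n x hx)).symm⟩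
  have h1 := htel n
  simp_rw [fun s => hn _ (hζ s)] at h1
  have h2 := sum_mul_sqrt_log_le_lintegral (N := fun u =>
    Metric.externalCoveringNumber u.toNNReal A) hD he0 (fun k u hu => by
      rw [he k]
      exact Metric.externalCoveringNumber_anti (Real.toNNReal_le_toNNReal hu)) n
  calc _ ≤ ENNReal.ofReal (12 * σ * ∑ k ∈ Finset.range n,
        D / 2 ^ (k + 1) * Real.sqrt (Real.log (e (k + 1)))) := ENNReal.ofReal_le_ofReal h1
    _ ≤ ENNReal.ofReal (12 * σ) * (2 * _) := by
      rw [ENNReal.ofReal_mul (by positivity)]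
      exact mul_le_mul_right h2 _
    _ = _ := by
      rw [← mul_assoc, ← ENNReal.ofReal_ofNat, ← ENNReal.ofReal_mul (by positivity)]
      congr 2
      ring

end Chaining

/-! ### Positive sets of size one: the race probability and Gibbs' inequality. -/

namespace SetRank

theorem expMeasure_Ioi {r : ℝ} (hr : 0 < r) {a : ℝ} (ha : 0 ≤ a) :
    expMeasure r (Set.Ioi a) = ENNReal.ofReal (Real.exp (-(r * a))) := by
  have := isProbabilityMeasure_expMeasure hr
  have h := cdf_expMeasure_eq hr a
  rw [cdf_eq_real, if_pos ha] at h
  rw [← Set.compl_Iic, ← ofReal_measureReal, probReal_compl_eq_one_sub measurableSet_Iic, h]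
  ring_nf

/-- Density of one variable at `a` times the probability that competitors of total rate `w` survive
beyond `a`: the minimum has rate `r + w`, and the given variable attains it with probability `r / (r
+ w)`. -/
theorem exponentialPDF_mul_exp {r w : ℝ} (hr : 0 < r) (hw : 0 ≤ w) (a : ℝ) :
    exponentialPDF r a * ENNReal.ofReal (Real.exp (-(w * a))) =
      ENNReal.ofReal (r / (r + w)) * exponentialPDF (r + w) a := by
  have hrw : 0 < r + w := by linarith
  rcases lt_or_ge a 0 with ha | ha
  · simp [exponentialPDF_of_neg ha]
  · rw [exponentialPDF_of_nonneg ha, exponentialPDF_of_nonneg ha,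
      ← ENNReal.ofReal_mul (by positivity), ← ENNReal.ofReal_mul (by positivity)]
    congr 1
    rw [mul_assoc, ← Real.exp_add, ← mul_assoc, div_mul_cancel₀ _ hrw.ne']
    ring_nf

/-- The probability that a given exponential variable is the smallest one. -/
theorem raceProb_singleton {φ : ℝ → ℝ} (hφ : ∀ x, 0 < φ x) {n : ℕ} (x : Fin (n + 1) → ℝ)
    (j : Fin (n + 1)) :
    raceProb φ x {j} = ENNReal.ofReal (φ (x j) / ∑ k, φ (x k)) := by
  have hprob : ∀ l, IsProbabilityMeasure (expMeasure (φ (x l))) := fun l =>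
    isProbabilityMeasure_expMeasure (hφ _)
  set T : Set (ℝ × (Fin n → ℝ)) := {p | ∀ k, p.1 < p.2 k}
  have hT : MeasurableSet T := by
    have : T = ⋂ k, {p | p.1 < p.2 k} := by ext; simp [T]
    rw [this]
    exact MeasurableSet.iInter fun k => measurableSet_lt (by fun_prop) (by fun_prop)
  have hmp := measurePreserving_piFinSuccAbove (fun l => expMeasure (φ (x l))) j
  have hpre : {y : Fin (n + 1) → ℝ | ∀ i ∈ ({j} : Finset (Fin (n + 1))),
      ∀ k ∉ ({j} : Finset (Fin (n + 1))), y i < y k} =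
      MeasurableEquiv.piFinSuccAbove (fun _ : Fin (n + 1) => ℝ) j ⁻¹' T := by
    ext y
    simp only [Finset.mem_singleton, forall_eq, T, Set.mem_preimage, Set.mem_ofPred_eq]
    exact ⟨fun h k => h _ (Fin.succAbove_ne j k), fun h k hk => by
      obtain ⟨l, rfl⟩ := Fin.exists_succAbove_eq hk
      exact h l⟩
  have hslice : ∀ a, 0 ≤ a → Measure.pi (fun k => expMeasure (φ (x (j.succAbove k))))
      (Prod.mk a ⁻¹' T) = ENNReal.ofReal
        (Real.exp (-((∑ k, φ (x (j.succAbove k))) * a))) := by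
    intro a ha
    have : Prod.mk a ⁻¹' T = Set.univ.pi fun _ => Set.Ioi a := by
      ext y; simp [T]
    rw [this, Measure.pi_pi]
    simp_rw [expMeasure_Ioi (hφ _) ha]
    rw [← ENNReal.ofReal_prod_of_nonneg fun _ _ => (Real.exp_pos _).le, ← Real.exp_sum,
      Finset.sum_neg_distrib, Finset.sum_mul]
  have hw : 0 ≤ ∑ k, φ (x (j.succAbove k)) := Finset.sum_nonneg fun k _ => (hφ _).le
  have hmeas : Measurable (exponentialPDF (φ (x j))) :=
    (measurable_exponentialPDFReal _).ennreal_ofReal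
  rw [raceProb, hpre, hmp.measure_preimage hT.nullMeasurableSet, Measure.prod_apply hT]
  have hdens : expMeasure (φ (x j)) = volume.withDensity (exponentialPDF (φ (x j))) := rfl
  rw [hdens, lintegral_withDensity_eq_lintegral_mul _ hmeas (measurable_measure_prodMk_left hT)]
  have hpt : ∀ a, (exponentialPDF (φ (x j)) * fun a =>
      Measure.pi (fun k => expMeasure (φ (x (j.succAbove k)))) (Prod.mk a ⁻¹' T)) a =
      ENNReal.ofReal (φ (x j) / (φ (x j) + ∑ k, φ (x (j.succAbove k)))) *
        exponentialPDF (φ (x j) + ∑ k, φ (x (j.succAbove k))) a := by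
    intro a
    rw [← exponentialPDF_mul_exp (hφ _) hw, Pi.mul_apply]
    rcases lt_or_ge a 0 with ha | ha
    · simp [exponentialPDF_of_neg ha]
    · rw [hslice a ha]
  rw [lintegral_congr hpt, lintegral_const_mul' _ _ ENNReal.ofReal_ne_top,
    lintegral_exponentialPDF_eq_one (by linarith [hφ (x j)]), mul_one, Fin.sum_univ_succAbove _ j]

/-- For positive sets of size one the excess risk is a Kullback-Leibler divergence. -/
theorem excessRisk_one_nonneg {φ : ℝ → ℝ} (hφ : ∀ x, 0 < φ x) {N M : ℕ}
    (Xs X : Matrix (Fin N) (Fin M) ℝ) : 0 ≤ excessRisk φ 1 Xs X := by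
  refine mul_nonneg (by positivity) (Finset.sum_nonneg fun i _ => ?_)
  rw [Finset.powersetCard_one, Finset.sum_map]
  cases M with
  | zero => simp
  | succ n =>
    have hpref : ∀ (x : Fin (n + 1) → ℝ) j, setPref φ x {j} = φ (x j) / ∑ k, φ (x k) := by
      intro x j
      rw [setPref, Finset.prod_singleton, ← Finset.sum_add_sum_compl {j}, Finset.sum_singleton]
    have hsum : ∀ x : Fin (n + 1) → ℝ, 0 < ∑ k, φ (x k) := fun x =>
      Finset.sum_pos (fun k _ => hφ _) Finset.univ_nonempty
    have hone : ∀ x : Fin (n + 1) → ℝ, ∑ j, φ (x j) / ∑ k, φ (x k) = 1 := fun x => by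
      rw [← Finset.sum_div, div_self (hsum x).ne']
    calc (0 : ℝ) = ∑ j, (φ (Xs i j) / ∑ k, φ (Xs i k) - φ (X i j) / ∑ k, φ (X i k)) := by
          rw [Finset.sum_sub_distrib, hone, hone, sub_self]
      _ ≤ _ := Finset.sum_le_sum fun j _ => ?_
    simp only [Function.Embedding.coeFn_mk]
    rw [raceProb_singleton hφ, hpref, hpref]
    have hp : 0 < φ (Xs i j) / ∑ k, φ (Xs i k) := div_pos (hφ _) (hsum _)
    have hq : 0 < φ (X i j) / ∑ k, φ (X i k) := div_pos (hφ _) (hsum _)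
    rw [ENNReal.toReal_ofReal hp.le]
    set p := φ (Xs i j) / ∑ k, φ (Xs i k)
    set q := φ (X i j) / ∑ k, φ (X i k)
    -- This gives `p * log (p / q) ≥ p - q` for each item, and the right-hand sides sum to zero.
    have h := Real.log_le_sub_one_of_pos (div_pos hq hp)
    rw [← inv_div p q, Real.log_inv, inv_div] at h
    have h2 := mul_le_mul_of_nonneg_left h hp.le
    have h3 : p * (q / p - 1) = q - p := by field_simp
    rw [h3] at h2
    linarith

end SetRank

/-! ### The centred loss process and the risk bound. -/

namespace SetRank

theorem setPref_pos {φ : ℝ → ℝ} (hφ : ∀ x, 0 < φ x) {M : ℕ} (x : Fin M → ℝ)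
    (S : Finset (Fin M)) : 0 < setPref φ x S :=
  Finset.prod_pos fun j _ => div_pos (hφ (x j))
    (add_pos_of_pos_of_nonneg (hφ (x j)) (Finset.sum_nonneg fun k _ => (hφ (x k)).le))

theorem log_setPref {φ : ℝ → ℝ} (hφ : ∀ x, 0 < φ x) {N M : ℕ} (X : Matrix (Fin N) (Fin M) ℝ)
    (i : Fin N) (S : Finset (Fin M)) :
    Real.log (setPref φ (X i) S) = -setLoss (logScore φ X i) S := by
  have hpos : ∀ j, 0 < φ (X i j) + ∑ k ∈ Sᶜ, φ (X i k) := fun j =>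
    add_pos_of_pos_of_nonneg (hφ _) (Finset.sum_nonneg fun k _ => (hφ _).le)
  rw [setPref, Real.log_prod fun j _ => (div_pos (hφ _) (hpos j)).ne', setLoss,
    ← Finset.sum_neg_distrib]
  refine Finset.sum_congr rfl fun j _ => ?_
  rw [Real.log_div (hφ _).ne' (hpos j).ne']
  simp [logScore, Real.exp_log (hφ _)]

theorem neg_log_totalPref {φ : ℝ → ℝ} (hφ : ∀ x, 0 < φ x) {N M : ℕ}
    (X : Matrix (Fin N) (Fin M) ℝ) (S : Fin N → Finset (Fin M)) :
    -Real.log (totalPref φ X S) = ∑ i, setLoss (logScore φ X i) (S i) := by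
  have h : Real.log (totalPref φ X S) = ∑ i, Real.log (setPref φ (X i) (S i)) :=
    Real.log_prod fun i _ => (setPref_pos hφ (X i) (S i)).ne'
  rw [h, ← Finset.sum_neg_distrib]
  exact Finset.sum_congr rfl fun i _ => by rw [log_setPref hφ, neg_neg]

theorem mul_excessRisk {φ : ℝ → ℝ} (hφ : ∀ x, 0 < φ x) {N M : ℕ} (hN : 0 < N) (J : ℕ)
    (Xs X : Matrix (Fin N) (Fin M) ℝ) :
    N * excessRisk φ J Xs X = ∑ i, ∑ S ∈ Finset.powersetCard J Finset.univ,
      (raceProb φ (Xs i) S).toReal *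
        (setLoss (logScore φ X i) S - setLoss (logScore φ Xs i) S) := by
  have hN' : (N : ℝ) ≠ 0 := by exact_mod_cast hN.ne'
  rw [excessRisk, ← mul_assoc, mul_one_div_cancel hN', one_mul]
  refine Finset.sum_congr rfl fun i _ => Finset.sum_congr rfl fun S _ => ?_
  rw [Real.log_div (setPref_pos hφ _ _).ne' (setPref_pos hφ _ _).ne', log_setPref hφ,
    log_setPref hφ]
  ring

section Generated

variable {φ : ℝ → ℝ} {N M J : ℕ} {Xs : Matrix (Fin N) (Fin M) ℝ} {Ω : Type*}
  [MeasurableSpace Ω] {μ : Measure Ω} {P : Ω → Fin N → Finset (Fin M)}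

theorem IsGeneratedFrom.measure_mem [IsProbabilityMeasure μ]
    (hP : IsGeneratedFrom φ J Xs μ P)
    (B : Finset (Fin N → Finset (Fin M))) :
    (μ {ω | P ω ∈ B}).toReal = ∑ s ∈ B, (μ {ω | P ω = s}).toReal := by
  have h : {ω | P ω ∈ B} = ⋃ s ∈ B, {ω | P ω = s} := by
    ext ω
    simp
  rw [h, measure_biUnion_finset, ENNReal.toReal_sum fun s _ => measure_ne_top _ _]
  · intro s _ s' _ hss
    rw [Function.onFun, Set.disjoint_left]
    intro ω h1 h2
    exact hss (h1.symm.trans h2)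
  · exact fun s _ => hP.measurableSet_fiber s

theorem IsGeneratedFrom.sum_measure [IsProbabilityMeasure μ]
    (hP : IsGeneratedFrom φ J Xs μ P) :
    ∑ s, (μ {ω | P ω = s}).toReal = 1 := by
  rw [← hP.measure_mem]
  simp

/-- Independence of the users as factorization of expectations. Data with some set of the wrong size
have an empty fibre, so the law on sets of size `J` decides everything. -/
theorem IsGeneratedFrom.sum_prod (hP : IsGeneratedFrom φ J Xs μ P)
    (g : Fin N → Finset (Fin M) → ℝ) :
    ∑ s, (μ {ω | P ω = s}).toReal * ∏ i, g i (s i) =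
      ∏ i, ∑ S ∈ Finset.powersetCard J Finset.univ, (raceProb φ (Xs i) S).toReal * g i S := by
  rw [Finset.prod_univ_sum]
  rw [← Finset.sum_subset (Finset.subset_univ
    (Fintype.piFinset fun _ : Fin N => Finset.powersetCard J (Finset.univ : Finset (Fin M))))]
  · refine Finset.sum_congr rfl fun s hs => ?_
    rw [hP.law s fun i => by
      simpa [Finset.mem_powersetCard] using Fintype.mem_piFinset.1 hs i,
      ENNReal.toReal_prod, ← Finset.prod_mul_distrib]
  · intro s _ hs
    have : {ω | P ω = s} = ∅ := by
      rw [Set.eq_empty_iff_forall_notMem]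
      rintro ω rfl
      exact hs (Fintype.mem_piFinset.2 fun i => by
        simpa [Finset.mem_powersetCard] using hP.card_eq ω i)
    simp [this]

/-- The existence of `P` with the prescribed law forces the product over the users of these masses
to be one; each is at most one, so each equals one. -/
theorem IsGeneratedFrom.sum_raceProb [IsProbabilityMeasure μ]
    (hP : IsGeneratedFrom φ J Xs μ P) (hφ : ∀ x, 0 < φ x)
    (hJ : J ≤ M) (i : Fin N) :
    ∑ S ∈ Finset.powersetCard J Finset.univ, (raceProb φ (Xs i) S).toReal = 1 := by
  have h := hP.sum_prod fun _ _ => 1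
  simp only [Finset.prod_const_one, mul_one, hP.sum_measure] at h
  rw [← Finset.mul_prod_erase _ _ (Finset.mem_univ i)] at h
  have h0 : ∀ k, 0 ≤ ∑ S ∈ Finset.powersetCard J Finset.univ, (raceProb φ (Xs k) S).toReal :=
    fun k => Finset.sum_nonneg fun S _ => ENNReal.toReal_nonneg
  refine le_antisymm (sum_raceProb_le_one hφ hJ (Xs i)) (h.le.trans ?_)
  exact mul_le_of_le_one_right (h0 i)
    (Finset.prod_le_one (fun k _ => h0 k) fun k _ => sum_raceProb_le_one hφ hJ (Xs k))

/-- The centred empirical loss of the log-scores `Z` at the data `s`. -/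
noncomputable def lossProcess (φ : ℝ → ℝ) {N M : ℕ} (J : ℕ) (Xs : Matrix (Fin N) (Fin M) ℝ)
    (Z : InfTwo N M) (s : Fin N → Finset (Fin M)) : ℝ :=
  ∑ i, (∑ S ∈ Finset.powersetCard J Finset.univ, (raceProb φ (Xs i) S).toReal * setLoss (Z i) S -
    setLoss (Z i) (s i))

theorem lossProcess_sub {φ : ℝ → ℝ} {N M J : ℕ} {Xs : Matrix (Fin N) (Fin M) ℝ}
    (Z Z' : InfTwo N M) (s : Fin N → Finset (Fin M)) :
    lossProcess φ J Xs Z s - lossProcess φ J Xs Z' s =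
      ∑ i, (∑ S ∈ Finset.powersetCard J Finset.univ, (raceProb φ (Xs i) S).toReal *
        (setLoss (Z i) S - setLoss (Z' i) S) - (setLoss (Z i) (s i) - setLoss (Z' i) (s i))) := by
  rw [lossProcess, lossProcess, ← Finset.sum_sub_distrib]
  refine Finset.sum_congr rfl fun i _ => ?_
  simp_rw [mul_sub, Finset.sum_sub_distrib]
  ring

theorem IsGeneratedFrom.lossProcess_mgf_le [IsProbabilityMeasure μ]
    (hP : IsGeneratedFrom φ J Xs μ P)
    (hφ : ∀ x, 0 < φ x) {K : ℕ} (hK : 0 < K) (hM : M = J + K) {α : ℝ} {Z Z' : InfTwo N M}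
    (hZ : ∀ i, ‖Z i‖ ≤ α) (hZ' : ∀ i, ‖Z' i‖ ≤ α) (t : ℝ) :
    ∑ s, (μ {ω | P ω = s}).toReal *
        Real.exp (t * (lossProcess φ J Xs Z s - lossProcess φ J Xs Z' s)) ≤
      Real.exp ((2 * Real.exp (6 * α) * (Real.sqrt M * (1 + (J : ℝ) / K)) * dist Z Z') ^ 2 *
        t ^ 2 / 2) := by
  -- The exchange bound for user `i`. With `M` coordinates the proxy is `M * c i ^ 2 / 4`, and the
  -- sum over `i` is the square of `2 * exp (6 * α) * √M * (1 + J / K) * dist Z Z'`. The parameter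
  -- becomes `-t` because the process is expected minus observed loss.
  set c : Fin N → ℝ := fun i => 4 * Real.exp (6 * α) * (1 + (J : ℝ) / K) * ‖Z i - Z' i‖
  have hlhs : ∀ s, Real.exp (t * (lossProcess φ J Xs Z s - lossProcess φ J Xs Z' s)) =
      ∏ i, Real.exp (-t * (setLoss (Z i) (s i) - setLoss (Z' i) (s i) -
        ∑ S ∈ Finset.powersetCard J Finset.univ, (raceProb φ (Xs i) S).toReal *
        (setLoss (Z i) S - setLoss (Z' i) S))) := by
    intro s
    rw [lossProcess_sub, ← Real.exp_sum, Finset.mul_sum]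
    congr 1
    exact Finset.sum_congr rfl fun i _ => by ring
  simp_rw [hlhs]
  rw [hP.sum_prod fun i T => Real.exp (-t * (setLoss (Z i) T - setLoss (Z' i) T -
        ∑ S ∈ Finset.powersetCard J Finset.univ, (raceProb φ (Xs i) S).toReal *
        (setLoss (Z i) S - setLoss (Z' i) S)))]
  have hi : ∀ i, ∑ T ∈ Finset.powersetCard J Finset.univ, (raceProb φ (Xs i) T).toReal *
      Real.exp (-t * (setLoss (Z i) T - setLoss (Z' i) T -
        ∑ S ∈ Finset.powersetCard J Finset.univ, (raceProb φ (Xs i) S).toReal *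
        (setLoss (Z i) S - setLoss (Z' i) S))) ≤ Real.exp (M * c i ^ 2 / 4 * (-t) ^ 2 / 2) := by
    intro i
    refine raceProb_mgf_le hφ (by omega) (Xs i) (hP.sum_raceProb hφ (by omega) i)
      (by positivity) (f := fun S => setLoss (Z i) S - setLoss (Z' i) S) ?_ (-t)
    intro R a b ha hb hab hR
    refine setLoss_sub_swap_le hK hM (fun l => ?_) (fun l => ?_) (fun l => ?_) ?_ ha hb hab hR
    · exact (norm_le_pi_norm (Z i) l).trans (hZ i)
    · exact (norm_le_pi_norm (Z' i) l).trans (hZ' i)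
    · exact norm_le_pi_norm (Z i - Z' i) l
    · linarith [norm_sub_le (Z i) (Z' i), hZ i, hZ' i]
  refine (Finset.prod_le_prod (fun i _ => Finset.sum_nonneg fun S _ => by positivity)
    fun i _ => hi i).trans (le_of_eq ?_)
  rw [← Real.exp_sum]
  congr 1
  have hdist : dist Z Z' ^ 2 = ∑ i, ‖Z i - Z' i‖ ^ 2 := by
    rw [dist_eq_norm, norm_infTwo, Real.sq_sqrt (Finset.sum_nonneg fun i _ => sq_nonneg _)]
    rfl
  rw [mul_pow, mul_pow, mul_pow (Real.sqrt M), Real.sq_sqrt (Nat.cast_nonneg M), hdist,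
    Finset.mul_sum, Finset.sum_mul, Finset.sum_div]
  refine Finset.sum_congr rfl fun i _ => ?_
  simp only [c]
  ring

/-- The two sides differ by the observed loss at `Xs` minus that at `X`, which is nonnegative
because `X` is optimal and `Xs` is feasible. -/
theorem IsConstrainedMLE.mul_excessRisk_le {𝓧 : Set (Matrix (Fin N) (Fin M) ℝ)}
    {X : Matrix (Fin N) (Fin M) ℝ} {s : Fin N → Finset (Fin M)}
    (hX : IsConstrainedMLE φ 𝓧 s X) (hφ : ∀ x, 0 < φ x) (hN : 0 < N) (hXs : Xs ∈ 𝓧) :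
    N * excessRisk φ J Xs X ≤
      lossProcess φ J Xs (logScore φ X) s - lossProcess φ J Xs (logScore φ Xs) s := by
  have h := hX.2 Xs hXs
  rw [neg_log_totalPref hφ, neg_log_totalPref hφ] at h
  rw [mul_excessRisk hφ hN, lossProcess_sub]
  simp only [Finset.sum_sub_distrib (f := fun i => ∑ S ∈ Finset.powersetCard J Finset.univ,
    (raceProb φ (Xs i) S).toReal * (setLoss (logScore φ X i) S - setLoss (logScore φ Xs i) S)),
    Finset.sum_sub_distrib (f := fun i => setLoss (logScore φ X i) (s i))]
  linarith

theorem entropyIntegral_mono {A B : Set (InfTwo N M)} (h : A ⊆ B) :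
    entropyIntegral A ≤ entropyIntegral B := by
  refine lintegral_mono fun u => ENNReal.rpow_le_rpow (EReal.toENNReal_le_toENNReal
    (ENNReal.log_monotone ?_)) (by norm_num)
  exact_mod_cast ENat.toENNReal_mono (Metric.externalCoveringNumber_mono_set h)

theorem IsGeneratedFrom.measure_excessRisk_le [IsProbabilityMeasure μ]
    (hP : IsGeneratedFrom φ J Xs μ P)
    (hφ : ∀ x, 0 < φ x) (hN : 0 < N) {K : ℕ} (hK : 0 < K) (hM : M = J + K) {α ε : ℝ}
    (hε : 0 < ε) {𝓧 : Set (Matrix (Fin N) (Fin M) ℝ)}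
    (h𝓧 : ∀ Z ∈ logScore φ '' 𝓧, ∀ i, ‖Z i‖ ≤ α) (hXs : Xs ∈ 𝓧)
    {Xhat : Ω → Matrix (Fin N) (Fin M) ℝ}
    (hXhat : ∀ᵐ ω ∂μ, IsConstrainedMLE φ 𝓧 (P ω) (Xhat ω)) :
    μ {ω | entropyIntegral (logScore φ '' 𝓧) *
        ENNReal.ofReal (48 * Real.exp (6 * α) / ε * (Real.sqrt M / N * (1 + (J : ℝ) / K)))
        < ENNReal.ofReal (excessRisk φ J Xs (Xhat ω))} ≤ ENNReal.ofReal ε := by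
  classical
  have hN' : (0 : ℝ) < N := by exact_mod_cast hN
  have hK' : (0 : ℝ) < K := by exact_mod_cast hK
  have hM' : (0 : ℝ) < M := by exact_mod_cast (by omega : 0 < M)
  set κ : ℝ := Real.sqrt M * (1 + (J : ℝ) / K) with hκ
  have hκ0 : 0 < κ := by positivity
  set c : ℝ := 48 * Real.exp (6 * α) / ε * (Real.sqrt M / N * (1 + (J : ℝ) / K)) with hc
  have hc0 : 0 < c := by positivity
  -- Here `24` is Dudley's constant, `2 * exp (6 * α) * κ` the sub-Gaussian scale, and `ε` the loss
  -- in Markov's inequality.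
  have hcε : N * c * ε = 24 * (2 * Real.exp (6 * α) * κ) := by
    rw [hc, hκ]; field_simp; ring
  set g := entropyIntegral (logScore φ '' 𝓧) with hg
  set bad : (Fin N → Finset (Fin M)) → Matrix (Fin N) (Fin M) ℝ → Prop := fun s X =>
    IsConstrainedMLE φ 𝓧 s X ∧ g * ENNReal.ofReal c < ENNReal.ofReal (excessRisk φ J Xs X)
  -- The data for which some constrained minimizer violates the bound. This event depends on `P`
  -- alone, so `Xhat` needs no measurability.
  set B : Finset (Fin N → Finset (Fin M)) := Finset.univ.filter fun s => ∃ X, bad s X with hB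
  have hsub : μ {ω | g * ENNReal.ofReal c < ENNReal.ofReal (excessRisk φ J Xs (Xhat ω))} ≤
      μ {ω | P ω ∈ B} := by
    refine measure_mono_ae ?_
    filter_upwards [hXhat] with ω h1 h2
    simp only [B, Finset.mem_filter, Finset.mem_univ, true_and]
    exact ⟨_, h1, h2⟩
  refine hsub.trans ?_
  rw [← ENNReal.ofReal_toReal (measure_ne_top μ {ω | P ω ∈ B}), hP.measure_mem]
  refine ENNReal.ofReal_le_ofReal (le_of_not_gt fun hlt => ?_)
  set q : (Fin N → Finset (Fin M)) → ℝ := fun s => (μ {ω | P ω = s}).toReal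
  have hq : ∀ s, 0 ≤ q s := fun s => ENNReal.toReal_nonneg
  obtain ⟨s₀, hs₀, hqs₀⟩ : ∃ s ∈ B, 0 < q s := by
    by_contra! h
    exact absurd (Finset.sum_nonpos h) (not_le.2 (hε.trans hlt))
  have hex : ∀ s, ∃ X, s ∈ B → bad s X := by
    intro s
    by_cases hs : s ∈ B
    · obtain ⟨X, hX⟩ := (Finset.mem_filter.1 hs).2
      exact ⟨X, fun _ => hX⟩
    · exact ⟨Xs, fun h => absurd h hs⟩
  choose Y hY using hex
  -- An infinite entropy integral would make the bound infinite, since `c > 0`, and no violation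
  -- could occur.
  have hgtop : g ≠ ⊤ := by
    intro h
    have := (hY s₀ hs₀).2
    rw [h, ENNReal.top_mul (by simpa using hc0)] at this
    exact not_top_lt this
  have hlow : ∀ s ∈ B, N * (g.toReal * c) < N * excessRisk φ J Xs (Y s) := by
    intro s hs
    have h := (hY s hs).2
    rw [← ENNReal.ofReal_toReal hgtop, ← ENNReal.ofReal_mul ENNReal.toReal_nonneg] at h
    exact mul_lt_mul_of_pos_left ((ENNReal.ofReal_lt_ofReal_iff'.1 h).1) hN'
  set z := logScore φ Xs
  -- Off `B` the index is the true one, where the increment vanishes. Thus the Markov argument works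
  -- although increments, and `D` itself when `J > 1`, may be negative.
  set ζ : (Fin N → Finset (Fin M)) → InfTwo N M := fun s => if s ∈ B then logScore φ (Y s) else z
  set A : Set (InfTwo N M) := insert z (Set.range ζ)
  have hAsub : A ⊆ logScore φ '' 𝓧 := by
    rintro _ (rfl | ⟨s, rfl⟩)
    · exact ⟨Xs, hXs, rfl⟩
    · by_cases hs : s ∈ B
      · simp only [ζ, if_pos hs]
        exact ⟨_, (hY s hs).1.1, rfl⟩
      · simp only [ζ, if_neg hs]
        exact ⟨Xs, hXs, rfl⟩
  have hdud := sum_selection_le_entropyIntegral hq hP.sum_measure (A := A)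
    ((Set.finite_range ζ).insert z) (σ := 2 * Real.exp (6 * α) * κ) (by positivity)
    (U := lossProcess φ J Xs)
    (fun x hx y hy t => hP.lossProcess_mgf_le hφ hK hM (h𝓧 _ (hAsub hx)) (h𝓧 _ (hAsub hy)) t)
    (Set.mem_insert z _) (ζ := ζ) fun s => Set.mem_insert_of_mem _ ⟨s, rfl⟩
  have hup := hdud.trans (mul_le_mul_right (entropyIntegral_mono hAsub) _)
  rw [← hg, ← ENNReal.ofReal_toReal hgtop, ← ENNReal.ofReal_mul (by positivity),
    ENNReal.ofReal_le_ofReal_iff (by positivity)] at hup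
  have hsum : ∑ s, q s * (lossProcess φ J Xs (ζ s) s - lossProcess φ J Xs z s) =
      ∑ s ∈ B, q s * (lossProcess φ J Xs (ζ s) s - lossProcess φ J Xs z s) := by
    refine (Finset.sum_subset (Finset.subset_univ B) fun s _ hs => ?_).symm
    simp [ζ, hs]
  have hpt : ∀ s ∈ B, N * (g.toReal * c) <
      lossProcess φ J Xs (ζ s) s - lossProcess φ J Xs z s := by
    intro s hs
    refine (hlow s hs).trans_le ?_
    simp only [ζ, if_pos hs]
    exact (hY s hs).1.mul_excessRisk_le hφ hN hXs
  -- Strictness comes from `s₀`, a bad data point of positive mass; it is needed because both sides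
  -- of the final comparison may vanish when `g = 0`.
  have hlt2 : ∑ s ∈ B, q s * (N * (g.toReal * c)) <
      ∑ s ∈ B, q s * (lossProcess φ J Xs (ζ s) s - lossProcess φ J Xs z s) :=
    Finset.sum_lt_sum (fun s hs => mul_le_mul_of_nonneg_left (hpt s hs).le (hq s))
      ⟨s₀, hs₀, mul_lt_mul_of_pos_left (hpt s₀ hs₀) hqs₀⟩
  rw [← Finset.sum_mul] at hlt2
  have hfin : ε * (N * (g.toReal * c)) ≤ (∑ s ∈ B, q s) * (N * (g.toReal * c)) := by
    gcongr
  have he : ε * (N * (g.toReal * c)) = 24 * (2 * Real.exp (6 * α) * κ) * g.toReal := by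
    rw [← hcε]; ring
  linarith

end Generated

end SetRank

theorem theorem2 (α ε : ℝ) (hε : 0 < ε) :
    ∃ C : ℝ, 0 < C ∧
      ∀ (N M J K : ℕ), 0 < N → 0 < J → 0 < K → M = J + K →
      ∀ φ : ℝ → ℝ, (∀ x, 0 < φ x) →
      ∀ 𝓧 : Set (Matrix (Fin N) (Fin M) ℝ),
      (∀ Z ∈ SetRank.logScore φ '' 𝓧, ∀ i, ‖Z i‖ ≤ α) →
      ∀ Xs ∈ 𝓧,
      ∀ (Ω : Type*) [MeasurableSpace Ω] (μ : Measure Ω) [IsProbabilityMeasure μ]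
        (P : Ω → Fin N → Finset (Fin M)), SetRank.IsGeneratedFrom φ J Xs μ P →
      ∀ Xhat : Ω → Matrix (Fin N) (Fin M) ℝ,
      (∀ᵐ ω ∂μ, SetRank.IsConstrainedMLE φ 𝓧 (P ω) (Xhat ω)) →
        (J = 1 → ∀ X : Matrix (Fin N) (Fin M) ℝ, 0 ≤ SetRank.excessRisk φ J Xs X) ∧
        μ {ω | SetRank.entropyIntegral (SetRank.logScore φ '' 𝓧) *
              ENNReal.ofReal (C * (Real.sqrt M / N * (1 + (J : ℝ) / K)))
            < ENNReal.ofReal (SetRank.excessRisk φ J Xs (Xhat ω))} ≤ ENNReal.ofReal ε := by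
  refine ⟨48 * Real.exp (6 * α) / ε, by positivity, ?_⟩
  intro N M J K hN hJ hK hM φ hφ 𝓧 h𝓧 Xs hXs Ω _ μ _ P hP Xhat hXhat
  refine ⟨?_, hP.measure_excessRisk_le hφ hN hK hM hε h𝓧 hXs hXhat⟩
  rintro rfl X
  exact SetRank.excessRisk_one_nonneg hφ Xs X
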